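/- Let $\Omega$ be a Polish space with its Borel $\sigma$-algebra (in particular $\Omega=\mathbb R^d$ or $\Omega=\mathbb T^d$), let $\mathcal P(\Omega)$ be the set of Borel probability measures on $\Omega$ with the weak topology, and let $\mathbf R=(R_1,\dots,R_L)$ be a vector of bounded continuous functions $R_l\colon\Omega\to\mathbb R$. Write $\mathbb E_\mu\mathbf R=\int\mathbf R\,d\mu\in\mathbb R^L$ and, for measures, $\|\eta\|_{TV}=\sup_{B}\big(|\eta(B)|+|\eta(\Omega\setminus B)|\big)$ with the supremum over Borel sets $B$. Call functions $f_1,\dots,f_n$ linearly independent modulo $\mu$ if $\mu(\{x:\sum_i c_if_i(x)=0\})=0$ for every $c\in\mathbb R^n\setminus\{0\}$. The matching domain $\mathcal D\subseteq\mathbb R^L\times\mathcal P(\Omega)$ is the set of pairs $(\mathbf m,\mu)$ such that * $1,R_1,\dots,R_L$ are linearly independent modulo $\mu$, and $\mathbf m$ lies in the interior of $\{\mathbb E_\nu\mathbf R:\ \nu\in\mathcal P(\Omega),\ \nu(\operatorname{supp}\mu)=1\}$; or * $\mathbf m=\mathbb E_\mu\mathbf R$. The matching operator $\mathcal M\colon\mathcal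 D\to\mathcal P(\Omega)$ assigns to $(\mathbf m,\mu)$ the minimiser of the relative entropy $\mathcal H(\nu\|\mu)$ over all $\nu\in\mathcal P(\Omega)$ with $\mathbb E_\nu\mathbf R=\mathbf m$. **Theorem.** Let $\Gamma\subseteq\mathcal D$ be compact in the $\|\cdot\|\times\text{weak}$ topology. Assume that for every pair $(\mathbf m,\mu)$ in the closure of $\{(\mathbf m',\mu')\in\Gamma:\ \mathbf m'\ne\mathbb E_{\mu'}\mathbf R\}$ and every $\boldsymbol\lambda\in\mathbb R^L\setminus\{\mathbf 0\}$ the function $\boldsymbol\lambda^{T}\mathbf R$ is not $\mu$-almost surely constant. (This holds in particular if $1,R_1,\dots,R_L$ are linearly independent modulo $\mu$ for every $(\mathbf m,\mu)\in\Gamma$.) Then for each $(\mathbf m,\mu)\in\Gamma$ the minimiser $\mathcal M(\mathbf m,\mu)$ exists and is unique, and there is a constant $C=C(\Gamma,\mathbf R)$ such that $$\|\mathcal M(\mathbf m,\mu_1)-\mathcal M(\mathbf m,\mu_2)\|_{TV}\le C\,\|\mu_1-\mu_2\|_{TV}$$ for all $\mathbf m,\mu_1,\mu_2$ with $(\mathbf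 m,\mu_1),(\mathbf m,\mu_2)\in\Gamma$. -/

import Mathlib

open MeasureTheory Set Topology

noncomputable section

namespace Matching

variable {Ω : Type*} [MeasurableSpace Ω]

/-- The total variation distance of two probability measures,
`‖μ - ν‖_TV = sup_B (|(μ - ν)(B)| + |(μ - ν)(Ω \ B)|)`, the supremum running over the measurable
sets `B` (the supremum is of a nonempty family bounded by `2`). -/
def tvDist (μ ν : ProbabilityMeasure Ω) : ℝ :=
  ⨆ B : {B : Set Ω // MeasurableSet B},
    (|(μ : Measure Ω).real B.1 - (ν : Measure Ω).real B.1| +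
      |(μ : Measure Ω).real (B.1)ᶜ - (ν : Measure Ω).real (B.1)ᶜ|)

/-- The restriction operator: the vector of expectations `E_ν[R_l]`. -/
def restriction {L : ℕ} (R : Fin L → Ω → ℝ) (ν : ProbabilityMeasure Ω) :
    EuclideanSpace ℝ (Fin L) :=
  WithLp.toLp 2 (fun l => ∫ x, R l x ∂(ν : Measure Ω))

/-- The moment space of a set `K ⊆ Ω`: all moment vectors of probability measures carried by `K`. -/
def momentSpace {L : ℕ} (K : Set Ω) (R : Fin L → Ω → ℝ) : Set (EuclideanSpace ℝ (Fin L)) :=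
  {m | ∃ ν : ProbabilityMeasure Ω, (ν : Measure Ω) Kᶜ = 0 ∧ restriction R ν = m}

/-- The functions `f i` are linearly independent modulo `μ`: the zero set of every nontrivial linear
combination is `μ`-null. -/
def LinIndepMod {n : ℕ} (f : Fin n → Ω → ℝ) (μ : ProbabilityMeasure Ω) : Prop :=
  ∀ c : Fin n → ℝ, c ≠ 0 → (μ : Measure Ω) {x | ∑ i, c i * f i x = 0} = 0

/-- The system `1, R_1, …, R_L`. -/
def withOne {L : ℕ} (R : Fin L → Ω → ℝ) : Fin (L + 1) → Ω → ℝ :=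
  Fin.cons (fun _ => (1 : ℝ)) R

/-- No nontrivial linear combination of `R_1, …, R_L` is `μ`-almost surely constant. -/
def NondegenerateMod {L : ℕ} (R : Fin L → Ω → ℝ) (μ : ProbabilityMeasure Ω) : Prop :=
  ∀ c : Fin L → ℝ, c ≠ 0 → ¬ ∃ a : ℝ, ∀ᵐ x ∂(μ : Measure Ω), ∑ l, c l * R l x = a

/-- The matching domain: pairs `(m, μ)` such that either `1, R_1, …, R_L` are linearly independent
modulo `μ` and `m` is interior to the moment space of the support of `μ`, or `m = E_μ[R]`. -/
def matchDomain [TopologicalSpace Ω] {L : ℕ} (R : Fin L → Ω → ℝ) :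
    Set (EuclideanSpace ℝ (Fin L) × ProbabilityMeasure Ω) :=
  {p | (LinIndepMod (withOne R) p.2 ∧
        p.1 ∈ interior (momentSpace (p.2 : Measure Ω).support R)) ∨
      p.1 = restriction R p.2}

/-- `ν` minimises the relative entropy with respect to `μ` among all probability measures whose
moment vector is `m`. -/
def IsMatching {L : ℕ} (R : Fin L → Ω → ℝ) (m : EuclideanSpace ℝ (Fin L))
    (μ ν : ProbabilityMeasure Ω) : Prop :=
  restriction R ν = m ∧
    ∀ ν' : ProbabilityMeasure Ω, restriction R ν' = m →
      InformationTheory.klDiv (ν : Measure Ω) (μ : Measure Ω) ≤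
        InformationTheory.klDiv (ν' : Measure Ω) (μ : Measure Ω)

open Classical in
/-- The matching operator: a minimiser of the relative entropy under the moment constraint
(with the irrelevant value `μ` if there is none). -/
def matching {L : ℕ} (R : Fin L → Ω → ℝ) (m : EuclideanSpace ℝ (Fin L))
    (μ : ProbabilityMeasure Ω) : ProbabilityMeasure Ω :=
  if h : ∃ ν, IsMatching R m μ ν then h.choose else μ

end Matching

end

/-! Fix a target m and write `centered` for the functions λ·(R - m). The quantity driving everything
is the spread ∫ (λ·(R - m))⁺ dμ. It is jointly continuous in (m, μ, λ), since bounded continuous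
integrands vary uniformly. It is positive for λ ≠ 0 at every pair in the closure of the unmatched
part of Γ: when m is interior to the moment space, some measure on the support has its mean pushed
in the direction λ; when m = E_μ R, nondegeneracy takes over. Compactness and homogeneity then give
a uniform bound c‖λ‖ (`exists_uniform_spread`).

The spread makes the partition function Z(λ) = ∫ exp(λ·(R - m)) dμ coercive: Z(λ) ≥ c‖λ‖ while Z(0)
= 1, so a minimiser exists in the ball of radius 1/c. Stationarity says that the tilt of μ by this λ
has moments m (`exists_tilt`), and the Pythagorean identity makes it the unique entropy minimiser
(`klDiv_tilted_le`). Pairs with m = E_μ R have λ = 0.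

For stability, the spread also bounds the second moment of λ·(R - m) from below by (c‖λ‖)², so the
gradient of Z is strongly monotone on bounded sets. Comparing the stationarity equations of two
measures bounds the difference of their parameters by their total variation distance
(`norm_sub_le_of_tilted`), and tilting is Lipschitz in measure and exponent (`tvDist_tilted_le`).
Spread is needed for only one of the two measures; if both are already matched, the operator fixes
them. -/

namespace Matching

/-! ### Total variation distance and integrals of bounded functions -/

section TotalVariation

variable {Ω : Type*} [MeasurableSpace Ω]

lemma bddAbove_tvDist (μ ν : ProbabilityMeasure Ω) :
    BddAbove (range fun B : {B : Set Ω // MeasurableSet B} =>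
      (|(μ : Measure Ω).real B.1 - (ν : Measure Ω).real B.1| +
        |(μ : Measure Ω).real (B.1)ᶜ - (ν : Measure Ω).real (B.1)ᶜ|)) := by
  refine ⟨2, ?_⟩
  rintro _ ⟨B, rfl⟩
  have key : ∀ S : Set Ω, |(μ : Measure Ω).real S - (ν : Measure Ω).real S| ≤ 1 := fun S => by
    have h1 : (μ : Measure Ω).real S ≤ 1 := measureReal_le_one
    have h2 : (ν : Measure Ω).real S ≤ 1 := measureReal_le_one
    have h3 : 0 ≤ (μ : Measure Ω).real S := measureReal_nonneg
    have h4 : 0 ≤ (ν : Measure Ω).real S := measureReal_nonneg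
    rw [abs_le]; constructor <;> linarith
  have := key B.1
  have := key (B.1)ᶜ
  show _ + _ ≤ (2 : ℝ)
  linarith

lemma abs_real_compl_sub (μ ν : ProbabilityMeasure Ω) {B : Set Ω} (hB : MeasurableSet B) :
    |(μ : Measure Ω).real Bᶜ - (ν : Measure Ω).real Bᶜ| =
      |(μ : Measure Ω).real B - (ν : Measure Ω).real B| := by
  rw [probReal_compl_eq_one_sub hB, probReal_compl_eq_one_sub hB, abs_sub_comm]
  congr 1
  ring

lemma two_mul_abs_real_sub_le_tvDist (μ ν : ProbabilityMeasure Ω) {B : Set Ω}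
    (hB : MeasurableSet B) :
    2 * |(μ : Measure Ω).real B - (ν : Measure Ω).real B| ≤ tvDist μ ν := by
  have h := le_ciSup (bddAbove_tvDist μ ν) ⟨B, hB⟩
  simp only [abs_real_compl_sub μ ν hB] at h
  calc _ = _ := two_mul _
    _ ≤ _ := h

lemma tvDist_le {μ ν : ProbabilityMeasure Ω} {a : ℝ}
    (h : ∀ B, MeasurableSet B → |(μ : Measure Ω).real B - (ν : Measure Ω).real B| ≤ a) :
    tvDist μ ν ≤ 2 * a := by
  have : Nonempty {B : Set Ω // MeasurableSet B} := ⟨⟨∅, MeasurableSet.empty⟩⟩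
  refine ciSup_le fun B => ?_
  rw [abs_real_compl_sub μ ν B.2]
  linarith [h B.1 B.2]

lemma tvDist_nonneg (μ ν : ProbabilityMeasure Ω) : 0 ≤ tvDist μ ν :=
  (by positivity : (0 : ℝ) ≤ 2 * |(μ : Measure Ω).real ∅ - (ν : Measure Ω).real ∅|).trans
    (two_mul_abs_real_sub_le_tvDist μ ν MeasurableSet.empty)

lemma tvDist_comm (μ ν : ProbabilityMeasure Ω) : tvDist μ ν = tvDist ν μ := by
  unfold tvDist
  congr 1
  funext B
  rw [abs_sub_comm, abs_sub_comm ((μ : Measure Ω).real (B.1)ᶜ)]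

lemma integrable_of_abs_le (μ : ProbabilityMeasure Ω) {f : Ω → ℝ} {M : ℝ} (hf : Measurable f)
    (hM : ∀ x, |f x| ≤ M) : Integrable f (μ : Measure Ω) :=
  Integrable.of_bound hf.aestronglyMeasurable M (Filter.Eventually.of_forall hM)

lemma integrable_exp_of_abs_le (μ : ProbabilityMeasure Ω) {f : Ω → ℝ} {M : ℝ} (hf : Measurable f)
    (hM : ∀ x, |f x| ≤ M) : Integrable (fun x => Real.exp (f x)) (μ : Measure Ω) :=
  integrable_of_abs_le μ hf.exp (M := Real.exp M) fun x => by
    rw [Real.abs_exp]; exact Real.exp_le_exp.2 ((le_abs_self _).trans (hM x))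

lemma integral_le_of_le (μ : ProbabilityMeasure Ω) {f : Ω → ℝ} {M : ℝ}
    (hf : Integrable f (μ : Measure Ω)) (hM : ∀ x, f x ≤ M) : ∫ x, f x ∂(μ : Measure Ω) ≤ M := by
  simpa using integral_mono hf (integrable_const M) hM

lemma le_integral_of_le (μ : ProbabilityMeasure Ω) {f : Ω → ℝ} {M : ℝ}
    (hf : Integrable f (μ : Measure Ω)) (hM : ∀ x, M ≤ f x) : M ≤ ∫ x, f x ∂(μ : Measure Ω) := by
  simpa using integral_mono (integrable_const M) hf hM

/-- Integrals of a bounded function against two measures differ by at most its bound times the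
total variation distance. -/
lemma abs_integral_sub_le_mul_tvDist (μ ν : ProbabilityMeasure Ω) {f : Ω → ℝ} {M : ℝ}
    (hf : Measurable f) (hM : ∀ x, |f x| ≤ M) :
    |∫ x, f x ∂(μ : Measure Ω) - ∫ x, f x ∂(ν : Measure Ω)| ≤ M * tvDist μ ν := by
  obtain ⟨x₀⟩ : Nonempty Ω := (μ : Measure Ω).nonempty_of_neZero
  have hM0 : 0 ≤ M := (abs_nonneg _).trans (hM x₀)
  -- Layer-cake formula, applied to f + M, which takes values in [0, 2M].
  have layer : ∀ ρ : ProbabilityMeasure Ω,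
      ∫ x, f x ∂(ρ : Measure Ω) + M =
        ∫ t in Ioc 0 (2 * M), (ρ : Measure Ω).real {x | t ≤ f x + M} := fun ρ => by
    have hi := integrable_of_abs_le ρ hf hM
    have h := Integrable.integral_eq_integral_Ioc_meas_le (μ := (ρ : Measure Ω))
      (f := fun x => f x + M) (M := 2 * M) (hi.add (integrable_const M))
      (Filter.Eventually.of_forall fun x => by
        have := (abs_le.1 (hM x)).1
        show 0 ≤ f x + M
        linarith)
      (Filter.Eventually.of_forall fun x => by
        have := (abs_le.1 (hM x)).2
        show f x + M ≤ 2 * M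
        linarith)
    rw [← h, integral_add hi (integrable_const M)]
    simp
  have hint : ∀ ρ : ProbabilityMeasure Ω,
      IntegrableOn (fun t => (ρ : Measure Ω).real {x | t ≤ f x + M}) (Ioc 0 (2 * M)) volume :=
    fun ρ => by
      have hanti : Antitone fun t => (ρ : Measure Ω).real {x | t ≤ f x + M} := fun s t hst =>
        measureReal_mono fun x (hx : t ≤ f x + M) => hst.trans hx
      exact Measure.integrableOn_of_bounded (M := 1) measure_Ioc_lt_top.ne
        hanti.measurable.aestronglyMeasurable
        (Filter.Eventually.of_forall fun t => by
          rw [Real.norm_of_nonneg measureReal_nonneg]; exact measureReal_le_one)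
  have heq : ∫ x, f x ∂(μ : Measure Ω) - ∫ x, f x ∂(ν : Measure Ω) =
      ∫ t in Ioc 0 (2 * M), ((μ : Measure Ω).real {x | t ≤ f x + M} -
        (ν : Measure Ω).real {x | t ≤ f x + M}) := by
    rw [integral_sub (hint μ) (hint ν), ← layer, ← layer]
    ring
  rw [heq, ← Real.norm_eq_abs]
  -- A set and its complement both count in the distance, whence the half; the length 2M of the
  -- interval compensates it.
  refine (norm_setIntegral_le_of_norm_le_const (C := tvDist μ ν / 2) measure_Ioc_lt_top
    fun t _ => ?_).trans (le_of_eq ?_)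
  · have := two_mul_abs_real_sub_le_tvDist μ ν
      (measurableSet_le measurable_const (hf.add_const M) : MeasurableSet {x | t ≤ f x + M})
    rw [Real.norm_eq_abs]
    linarith
  · rw [Real.volume_real_Ioc_of_le (by linarith)]
    ring

end TotalVariation

/-! ### Relative entropy and exponential tilts -/

section RelativeEntropy

open InformationTheory

variable {Ω : Type*} [MeasurableSpace Ω]

/-- The Pythagorean identity for an exponential tilt. -/
lemma toReal_klDiv_tilted_right (μ ν : ProbabilityMeasure Ω) {f : Ω → ℝ} {M : ℝ}
    (hf : Measurable f) (hM : ∀ x, |f x| ≤ M) (h0 : ∫ x, f x ∂(ν : Measure Ω) = 0)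
    (hfin : klDiv (ν : Measure Ω) (μ : Measure Ω) ≠ ⊤) :
    (klDiv (ν : Measure Ω) ((μ : Measure Ω).tilted f)).toReal =
      (klDiv (ν : Measure Ω) (μ : Measure Ω)).toReal +
        Real.log (∫ x, Real.exp (f x) ∂(μ : Measure Ω)) := by
  obtain ⟨hac, hll⟩ := klDiv_ne_top_iff.1 hfin
  have hexp : Integrable (fun x => Real.exp (f x)) (μ : Measure Ω) :=
    integrable_exp_of_abs_le μ hf hM
  have hfν := integrable_of_abs_le ν hf hM
  have := isProbabilityMeasure_tilted hexp
  rw [toReal_klDiv_of_measure_eq (hac.trans (absolutelyContinuous_tilted hexp)) (by simp),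
    toReal_klDiv_of_measure_eq hac (by simp), integral_llr_tilted_right hac hfν hexp hll, h0]
  ring

lemma klDiv_tilted_self_ne_top (μ : ProbabilityMeasure Ω) {f : Ω → ℝ} {M : ℝ}
    (hf : Measurable f) (hM : ∀ x, |f x| ≤ M) :
    klDiv ((μ : Measure Ω).tilted f) (μ : Measure Ω) ≠ ⊤ := by
  have hexp : Integrable (fun x => Real.exp (f x)) (μ : Measure Ω) :=
    integrable_exp_of_abs_le μ hf hM
  have := isProbabilityMeasure_tilted hexp
  have hac := tilted_absolutelyContinuous (μ : Measure Ω) f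
  refine klDiv_ne_top hac ?_
  have h := hac.ae_le (log_rnDeriv_tilted_left_self hexp)
  refine (integrable_congr h).2 (Integrable.sub ?_ (integrable_const _))
  exact Integrable.of_bound hf.aestronglyMeasurable M (Filter.Eventually.of_forall hM)

/-- The Pythagorean identity at τ itself gives H(τ|μ) = -log ∫ exp f dμ; at ν of finite entropy it
becomes H(ν|μ) = H(τ|μ) + H(ν|τ). The last term is nonnegative and vanishes only for ν = τ. -/
lemma klDiv_tilted_le (μ ν τ : ProbabilityMeasure Ω) {f : Ω → ℝ} {M : ℝ}
    (hf : Measurable f) (hM : ∀ x, |f x| ≤ M) (hτ : (τ : Measure Ω) = (μ : Measure Ω).tilted f)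
    (h0 : ∫ x, f x ∂(ν : Measure Ω) = 0) (h0' : ∫ x, f x ∂(τ : Measure Ω) = 0) :
    klDiv (τ : Measure Ω) (μ : Measure Ω) ≤ klDiv (ν : Measure Ω) (μ : Measure Ω) ∧
      (klDiv (ν : Measure Ω) (μ : Measure Ω) ≤ klDiv (τ : Measure Ω) (μ : Measure Ω) → ν = τ) := by
  have hτfin : klDiv (τ : Measure Ω) (μ : Measure Ω) ≠ ⊤ :=
    hτ ▸ klDiv_tilted_self_ne_top μ hf hM
  have h2 := toReal_klDiv_tilted_right μ τ hf hM h0' hτfin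
  rw [← hτ, klDiv_self, ENNReal.toReal_zero] at h2
  by_cases hν : klDiv (ν : Measure Ω) (μ : Measure Ω) = ⊤
  · exact ⟨hν ▸ le_top, fun h => absurd (top_le_iff.1 (hν ▸ h)) hτfin⟩
  have h1 := toReal_klDiv_tilted_right μ ν hf hM h0 hν
  rw [← hτ] at h1
  have hnn : 0 ≤ (klDiv (ν : Measure Ω) (τ : Measure Ω)).toReal := ENNReal.toReal_nonneg
  refine ⟨(ENNReal.toReal_le_toReal hτfin hν).1 (by linarith), fun h => ?_⟩
  have h' := (ENNReal.toReal_le_toReal hν hτfin).2 h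
  have hz : (klDiv (ν : Measure Ω) (τ : Measure Ω)).toReal = 0 := by linarith
  -- Needed because `toReal` also sends `⊤` to 0.
  have hne : klDiv (ν : Measure Ω) (τ : Measure Ω) ≠ ⊤ := by
    have hexp : Integrable (fun x => Real.exp (f x)) (μ : Measure Ω) :=
      integrable_exp_of_abs_le μ hf hM
    obtain ⟨hac, hll⟩ := klDiv_ne_top_iff.1 hν
    rw [hτ]
    exact klDiv_ne_top (hac.trans (absolutelyContinuous_tilted hexp))
      (integrable_llr_tilted_right hac (integrable_of_abs_le ν hf hM) hll hexp)
  have hkl := ((ENNReal.toReal_eq_zero_iff _).1 hz).resolve_right hne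
  rw [klDiv_eq_zero_iff] at hkl
  exact Subtype.ext hkl

end RelativeEntropy

end Matching

namespace Matching

/-! ### Centred moments, the partition function and the entropy minimiser -/

section Centered

variable {Ω : Type*} {L : ℕ}

/-- The linear combination with coefficients `l` of the functions `R_i - m_i`. -/
def centered (R : Fin L → Ω → ℝ) (m l : EuclideanSpace ℝ (Fin L)) (x : Ω) : ℝ :=
  ∑ i, l i * (R i x - m i)

variable {R : Fin L → Ω → ℝ} {m : EuclideanSpace ℝ (Fin L)} {B : ℝ}

@[simp] lemma centered_zero (x : Ω) : centered R m 0 x = 0 := by simp [centered]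

lemma centered_add (l l' : EuclideanSpace ℝ (Fin L)) (x : Ω) :
    centered R m (l + l') x = centered R m l x + centered R m l' x := by
  simp [centered, add_mul, Finset.sum_add_distrib]

lemma centered_sub (l l' : EuclideanSpace ℝ (Fin L)) (x : Ω) :
    centered R m (l - l') x = centered R m l x - centered R m l' x := by
  simp [centered, sub_mul, Finset.sum_sub_distrib]

lemma centered_smul (t : ℝ) (l : EuclideanSpace ℝ (Fin L)) (x : Ω) :
    centered R m (t • l) x = t * centered R m l x := by
  simp [centered, Finset.mul_sum, mul_assoc]

lemma abs_centered_le (hB : ∀ i x, |R i x| ≤ B) (hm : ∀ i, |m i| ≤ B)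
    (l : EuclideanSpace ℝ (Fin L)) (x : Ω) : |centered R m l x| ≤ L * (2 * B) * ‖l‖ := by
  have h : ∀ i ∈ Finset.univ, |l i * (R i x - m i)| ≤ ‖l‖ * (2 * B) := fun i _ => by
    rw [abs_mul]
    refine mul_le_mul (PiLp.norm_apply_le l i) ?_ (abs_nonneg _) (norm_nonneg _)
    calc |R i x - m i| ≤ |R i x| + |m i| := abs_sub _ _
      _ ≤ 2 * B := by linarith [hB i x, hm i]
  refine (Finset.abs_sum_le_sum_abs _ _).trans ((Finset.sum_le_sum h).trans (le_of_eq ?_))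
  simp
  ring

lemma continuous_centered_coeff (x : Ω) : Continuous fun l => centered R m l x := by
  unfold centered
  fun_prop

variable [MeasurableSpace Ω]

lemma tilted_centered_zero (μ : ProbabilityMeasure Ω) :
    (μ : Measure Ω).tilted (centered R m 0) = μ := by
  have h : centered R m 0 = fun _ => 0 := funext centered_zero
  rw [h, tilted_const]

lemma measurable_centered (hR : ∀ i, Measurable (R i)) (l : EuclideanSpace ℝ (Fin L)) :
    Measurable (centered R m l) := by
  unfold centered
  fun_prop

lemma integrable_centered (hR : ∀ i, Measurable (R i)) (hB : ∀ i x, |R i x| ≤ B)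
    (hm : ∀ i, |m i| ≤ B) (l : EuclideanSpace ℝ (Fin L)) (μ : ProbabilityMeasure Ω) :
    Integrable (centered R m l) (μ : Measure Ω) :=
  integrable_of_abs_le μ (measurable_centered hR l) (abs_centered_le hB hm l)

lemma abs_restriction_le (hR : ∀ i, Measurable (R i)) (hB : ∀ i x, |R i x| ≤ B)
    (μ : ProbabilityMeasure Ω) (i : Fin L) : |restriction R μ i| ≤ B := by
  have hi := integrable_of_abs_le μ (hR i) (hB i)
  exact abs_le.2 ⟨le_integral_of_le μ hi fun x => (abs_le.1 (hB i x)).1,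
    integral_le_of_le μ hi fun x => (abs_le.1 (hB i x)).2⟩

lemma integral_centered (hR : ∀ i, Measurable (R i)) (hB : ∀ i x, |R i x| ≤ B)
    (l : EuclideanSpace ℝ (Fin L)) (μ : ProbabilityMeasure Ω) :
    ∫ x, centered R m l x ∂(μ : Measure Ω) = ∑ i, l i * (restriction R μ i - m i) := by
  have hi := fun i => integrable_of_abs_le μ (hR i) (hB i)
  have hterm : ∀ i ∈ Finset.univ, Integrable (fun x => l i * (R i x - m i)) (μ : Measure Ω) :=
    fun i _ => ((hi i).sub (integrable_const _)).const_mul _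
  unfold centered
  rw [integral_finsetSum _ hterm]
  refine Finset.sum_congr rfl fun i _ => ?_
  rw [integral_const_mul, integral_sub (hi i) (integrable_const _)]
  simp [restriction]

/-- A strictly spread family of moments admits an exponential tilt with vanishing centred moments:
the minimiser of the partition function. -/
lemma exists_tilt (hR : ∀ i, Measurable (R i)) (hB : ∀ i x, |R i x| ≤ B) (hm : ∀ i, |m i| ≤ B)
    (μ : ProbabilityMeasure Ω) {c : ℝ} (hc : 0 < c)
    (hspread : ∀ l, c * ‖l‖ ≤ ∫ x, max (centered R m l x) 0 ∂(μ : Measure Ω)) :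
    ∃ l : EuclideanSpace ℝ (Fin L), ‖l‖ ≤ 1 / c ∧
      ∀ l', ∫ x, centered R m l' x ∂((μ : Measure Ω).tilted (centered R m l)) = 0 := by
  set Z : EuclideanSpace ℝ (Fin L) → ℝ :=
    fun l => ∫ x, Real.exp (centered R m l x) ∂(μ : Measure Ω) with hZ
  have hexp : ∀ l, Integrable (fun x => Real.exp (centered R m l x)) (μ : Measure Ω) := fun l =>
    integrable_exp_of_abs_le μ (measurable_centered hR l) (abs_centered_le hB hm l)
  have hZ0 : Z 0 = 1 := by simp [hZ]
  -- Coercivity comes from exp t ≥ max t 0.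
  have hZc : ∀ l, c * ‖l‖ ≤ Z l := fun l => by
    refine (hspread l).trans (integral_mono ((integrable_centered hR hB hm l μ).pos_part)
      (hexp l) fun x => max_le ?_ (Real.exp_pos _).le)
    linarith [Real.add_one_le_exp (centered R m l x)]
  have hcont : Continuous Z := by
    refine continuous_iff_continuousAt.2 fun l₀ => ?_
    have hBL : 0 ≤ L * (2 * B) := by
      rcases Nat.eq_zero_or_pos L with rfl | hL
      · simp
      · have := (abs_nonneg _).trans (hm ⟨0, hL⟩)
        positivity
    refine continuousAt_of_dominated (bound := fun _ => Real.exp (L * (2 * B) * (‖l₀‖ + 1)))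
      (Filter.Eventually.of_forall fun l => (hexp l).aestronglyMeasurable) ?_
      (integrable_const _)
      (Filter.Eventually.of_forall fun x =>
        (Real.continuous_exp.comp (continuous_centered_coeff x)).continuousAt)
    filter_upwards [continuous_norm.continuousAt.eventually
      (gt_mem_nhds (lt_add_one ‖l₀‖))] with l hl
    refine Filter.Eventually.of_forall fun x => ?_
    rw [Real.norm_eq_abs, Real.abs_exp, Real.exp_le_exp]
    exact (le_abs_self _).trans ((abs_centered_le hB hm l x).trans
      (mul_le_mul_of_nonneg_left hl.le hBL))
  obtain ⟨l, hl⟩ := hcont.exists_forall_le' 0 (by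
    filter_upwards [(tendsto_norm_cocompact_atTop
      (E := EuclideanSpace ℝ (Fin L))).eventually_ge_atTop (1 / c)] with l hl
    rw [hZ0]
    refine le_trans ?_ (hZc l)
    rw [div_le_iff₀ hc] at hl
    linarith)
  refine ⟨l, ?_, fun l' => ?_⟩
  · rw [le_div_iff₀ hc]
    linarith [hZc l, hl 0]
  · have := isProbabilityMeasure_tilted (hexp l)
    set τ : Measure Ω := (μ : Measure Ω).tilted (centered R m l) with hτ
    have hset : ProbabilityTheory.integrableExpSet (centered R m l') τ = univ := by
      refine eq_univ_of_forall fun t => ?_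
      refine integrable_exp_of_abs_le ⟨τ, this⟩
        (f := fun x => t * centered R m l' x) (M := L * (2 * B) * ‖t • l'‖)
        ((measurable_centered hR l').const_mul t) fun x => ?_
      rw [← centered_smul]
      exact abs_centered_le hB hm _ x
    rw [← ProbabilityTheory.deriv_mgf_zero (X := centered R m l') (μ := τ) (by simp [hset])]
    -- The tilted mean is the derivative at 0 of the moment generating function t ↦ Z(l + t l') /
    -- Z(l), which is minimal at t = 0.
    refine IsLocalMin.deriv_eq_zero (Filter.Eventually.of_forall fun t => ?_)
    have hmgf : ∀ t, ProbabilityTheory.mgf (centered R m l') τ t = Z (l + t • l') / Z l :=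
      fun t => by
        rw [ProbabilityTheory.mgf, hτ,
          integral_exp_tilted (centered R m l) (fun x => t * centered R m l' x)]
        simp only [hZ, centered_add, centered_smul, Pi.add_apply]
    simp only [hmgf, zero_smul, add_zero]
    exact div_le_div_of_nonneg_right (hl _) (integral_nonneg fun x => (Real.exp_pos _).le)

/-- An exponential tilt with vanishing centred moments is the unique entropy minimiser. -/
lemma isMatching_iff_eq_tilted (hR : ∀ i, Measurable (R i)) (hB : ∀ i x, |R i x| ≤ B)
    (hm : ∀ i, |m i| ≤ B) {μ τ : ProbabilityMeasure Ω} {l : EuclideanSpace ℝ (Fin L)}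
    (hτ : (τ : Measure Ω) = (μ : Measure Ω).tilted (centered R m l))
    (h0 : ∀ l', ∫ x, centered R m l' x ∂(τ : Measure Ω) = 0) (ν : ProbabilityMeasure Ω) :
    IsMatching R m μ ν ↔ ν = τ := by
  have hτm : restriction R τ = m := by
    ext i
    have h := h0 (EuclideanSpace.single i 1)
    rw [integral_centered hR hB] at h
    simpa [Pi.single_apply, sub_eq_zero] using h
  have hmean : ∀ ν : ProbabilityMeasure Ω, restriction R ν = m →
      ∫ x, centered R m l x ∂(ν : Measure Ω) = 0 := fun ν hν => by
    rw [integral_centered hR hB, hν]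
    simp
  have key := fun (ν : ProbabilityMeasure Ω) (hν : restriction R ν = m) =>
    klDiv_tilted_le μ ν τ (measurable_centered hR l) (abs_centered_le hB hm l) hτ
      (hmean ν hν) (h0 l)
  constructor
  · exact fun h => (key ν h.1).2 (h.2 τ hτm)
  · rintro rfl
    exact ⟨hτm, fun ν' hν' => (key ν' hν').1⟩

lemma matching_eq_of_forall_iff {μ τ : ProbabilityMeasure Ω}
    (h : ∀ ν, IsMatching R m μ ν ↔ ν = τ) : matching R m μ = τ := by
  have hex : ∃ ν, IsMatching R m μ ν := ⟨τ, (h τ).2 rfl⟩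
  rw [matching, dif_pos hex]
  exact (h _).1 hex.choose_spec

/-- A function of mean zero whose positive part has integral zero vanishes almost surely; here that
would make a nontrivial combination of the R_i almost surely constant. -/
lemma integral_centered_pos_of_nondegenerate (hR : ∀ i, Measurable (R i))
    (hB : ∀ i x, |R i x| ≤ B) {l : EuclideanSpace ℝ (Fin L)} {μ : ProbabilityMeasure Ω}
    (hnd : NondegenerateMod R μ) (hl : l ≠ 0) :
    0 < ∫ x, max (centered R (restriction R μ) l x) 0 ∂(μ : Measure Ω) := by
  have hi := integrable_centered hR hB (abs_restriction_le hR hB μ) l μ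
  refine lt_of_le_of_ne (integral_nonneg fun x => le_max_right _ _) fun h0 => ?_
  have hpos := (integral_eq_zero_iff_of_nonneg (fun x => le_max_right _ _) hi.pos_part).1 h0.symm
  have hmean : ∫ x, -centered R (restriction R μ) l x ∂(μ : Measure Ω) = 0 := by
    rw [integral_neg, integral_centered hR hB]
    simp
  have hzero := (integral_eq_zero_iff_of_nonneg_ae (hpos.mono fun x hx => by
    have : centered R (restriction R μ) l x ≤ 0 := max_eq_right_iff.1 hx
    show (0 : ℝ) ≤ -_
    linarith) hi.neg).1 hmean
  refine hnd l.ofLp (fun h => hl (by ext i; simp [h])) ⟨∑ i, l i * restriction R μ i, ?_⟩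
  filter_upwards [hzero] with x hx
  have hx' : centered R (restriction R μ) l x = 0 := by simpa using hx
  simp only [centered, mul_sub, Finset.sum_sub_distrib] at hx'
  linarith

end Centered

end Matching

namespace Matching

/-! ### Uniform spread on compact sets -/

section Spread

open scoped BoundedContinuousFunction

variable {Ω : Type*} [TopologicalSpace Ω] [MeasurableSpace Ω] [OpensMeasurableSpace Ω] {L : ℕ}

/-- Integration is jointly continuous in the bounded continuous integrand and the measure. -/
lemma continuous_integral_boundedContinuousFunction_prod :
    Continuous fun q : (Ω →ᵇ ℝ) × ProbabilityMeasure Ω => ∫ x, q.1 x ∂(q.2 : Measure Ω) := by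
  refine continuous_iff_continuousAt.2 fun ⟨g₀, μ₀⟩ => ?_
  -- Split g = g₀ + (g - g₀): weak convergence handles the first term, the sup norm the second.
  have h1 : Filter.Tendsto (fun q : (Ω →ᵇ ℝ) × ProbabilityMeasure Ω =>
      ∫ x, g₀ x ∂(q.2 : Measure Ω)) (𝓝 (g₀, μ₀)) (𝓝 (∫ x, g₀ x ∂(μ₀ : Measure Ω))) :=
    ProbabilityMeasure.tendsto_iff_forall_integral_tendsto.1
      (continuous_snd.tendsto (g₀, μ₀)) g₀
  have h2 : Filter.Tendsto (fun q : (Ω →ᵇ ℝ) × ProbabilityMeasure Ω =>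
      ∫ x, (q.1 - g₀) x ∂(q.2 : Measure Ω)) (𝓝 (g₀, μ₀)) (𝓝 0) := by
    refine squeeze_zero_norm (a := fun q => ‖q.1 - g₀‖) (fun q => ?_) ?_
    · exact (q.1 - g₀).norm_integral_le_norm (q.2 : Measure Ω)
    · have : Continuous fun q : (Ω →ᵇ ℝ) × ProbabilityMeasure Ω => ‖q.1 - g₀‖ := by fun_prop
      simpa using this.tendsto (g₀, μ₀)
  have h3 := h1.add h2
  rw [add_zero] at h3
  refine h3.congr fun q => ?_
  rw [← integral_add (g₀.integrable _) ((q.1 - g₀).integrable _)]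
  simp

variable {R : Fin L → Ω → ℝ} {B : ℝ}

/-- The integral of the positive part of a centred combination is jointly continuous. -/
lemma continuous_integral_centered_pos (hcont : ∀ i, Continuous (R i))
    (hB : ∀ i x, |R i x| ≤ B) :
    Continuous fun q : (EuclideanSpace ℝ (Fin L) × ProbabilityMeasure Ω) ×
        EuclideanSpace ℝ (Fin L) =>
      ∫ x, max (centered R q.1.1 q.2 x) 0 ∂(q.1.2 : Measure Ω) := by
  let Rb : Fin L → Ω →ᵇ ℝ := fun i =>
    BoundedContinuousFunction.ofNormedAddCommGroup (R i) (hcont i) B (hB i)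
  let G : (EuclideanSpace ℝ (Fin L) × ProbabilityMeasure Ω) ×
      EuclideanSpace ℝ (Fin L) → Ω →ᵇ ℝ := fun q =>
    (∑ i, q.2 i • (Rb i - q.1.1 i • (1 : Ω →ᵇ ℝ))) ⊔ 0
  have hG : Continuous G := by
    refine Continuous.sup ?_ continuous_const
    fun_prop
  refine (continuous_integral_boundedContinuousFunction_prod.comp
    (hG.prodMk (continuous_snd.comp continuous_fst))).congr fun q => ?_
  refine integral_congr_ae (Filter.Eventually.of_forall fun x => ?_)
  simp [G, centered, Rb]

/-- For small t > 0 the point m + t l is the moment vector of a measure carried by the support of μ.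
Its centred mean in direction l is t‖l‖² > 0, so the continuous integrand is positive at some
support point, hence on a neighbourhood of positive μ-measure. -/
lemma integral_centered_pos_of_mem_interior (hcont : ∀ i, Continuous (R i))
    (hB : ∀ i x, |R i x| ≤ B) {m l : EuclideanSpace ℝ (Fin L)} {μ : ProbabilityMeasure Ω}
    (hm : m ∈ interior (momentSpace (μ : Measure Ω).support R)) (hl : l ≠ 0) :
    0 < ∫ x, max (centered R m l x) 0 ∂(μ : Measure Ω) := by
  have hR := fun i => (hcont i).measurable
  have hcc : Continuous (centered R m l) := by unfold centered; fun_prop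
  obtain ⟨t, ht, htm⟩ : ∃ t : ℝ, 0 < t ∧
      m + t • l ∈ momentSpace (μ : Measure Ω).support R := by
    have hline : Continuous fun t : ℝ => m + t • l := by fun_prop
    have h1 : ∀ᶠ t in 𝓝 (0 : ℝ), m + t • l ∈ momentSpace (μ : Measure Ω).support R :=
      hline.continuousAt.eventually (by simpa using mem_interior_iff_mem_nhds.1 hm)
    obtain ⟨t, ht⟩ := ((h1.filter_mono nhdsWithin_le_nhds).and
      (self_mem_nhdsWithin : Ioi (0 : ℝ) ∈ 𝓝[>] 0)).exists
    exact ⟨t, ht.2, ht.1⟩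
  obtain ⟨ν, hν, hνm⟩ := htm
  have hmean : 0 < ∫ x, centered R m l x ∂(ν : Measure Ω) := by
    rw [integral_centered hR hB, hνm]
    have : ∑ i, l i * ((m + t • l) i - m i) = t * ‖l‖ ^ 2 := by
      rw [EuclideanSpace.real_norm_sq_eq, Finset.mul_sum]
      refine Finset.sum_congr rfl fun i _ => ?_
      simp
      ring
    rw [this]
    positivity
  obtain ⟨x, hx, hpos⟩ : ∃ x ∈ (μ : Measure Ω).support, 0 < centered R m l x := by
    by_contra! hcon
    refine absurd hmean (not_lt.2 (integral_nonpos_of_ae ?_))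
    filter_upwards [compl_mem_ae_iff.2 hν] with x hx
    exact hcon x (not_not.1 hx)
  have hmax : Continuous fun x => max (centered R m l x) 0 := hcc.max continuous_const
  refine (integral_pos_iff_support_of_nonneg (fun x => le_max_right _ _) ?_).2 ?_
  · have hi : Integrable (fun x => max (centered R m l x) 0) (μ : Measure Ω) := by
      have hg : ∀ x, |centered R m l x| ≤ ∑ i, |l i| * (B + |m i|) := fun x =>
        (Finset.abs_sum_le_sum_abs _ _).trans (Finset.sum_le_sum fun i _ => by
          rw [abs_mul]
          exact mul_le_mul_of_nonneg_left ((abs_sub _ _).trans (by linarith [hB i x]))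
            (abs_nonneg _))
      exact (integrable_of_abs_le μ hcc.measurable hg).pos_part
    exact hi
  · refine (Measure.mem_support_iff_forall x).1 hx _ ?_
    exact hmax.isOpen_support.mem_nhds (by simp [hpos])

/-- On a compact set where the centred moments are spread in every direction, the spread is
uniform. -/
lemma exists_uniform_spread (hcont : ∀ i, Continuous (R i)) (hB : ∀ i x, |R i x| ≤ B)
    {N : Set (EuclideanSpace ℝ (Fin L) × ProbabilityMeasure Ω)} (hN : IsCompact N)
    (hpos : ∀ p ∈ N, ∀ l ≠ 0, 0 < ∫ x, max (centered R p.1 l x) 0 ∂(p.2 : Measure Ω)) :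
    ∃ c, 0 < c ∧ ∀ p ∈ N, ∀ l,
      c * ‖l‖ ≤ ∫ x, max (centered R p.1 l x) 0 ∂(p.2 : Measure Ω) := by
  obtain ⟨c, hc, hmin⟩ :=
    (hN.prod (isCompact_sphere (0 : EuclideanSpace ℝ (Fin L)) 1)).exists_forall_le'
    (continuous_integral_centered_pos hcont hB).continuousOn (a := 0)
    fun q hq => hpos q.1 hq.1 q.2 (ne_zero_of_mem_unit_sphere ⟨q.2, hq.2⟩)
  refine ⟨c, hc, fun p hp l => ?_⟩
  rcases eq_or_ne l 0 with rfl | hl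
  · simp
  have hn : 0 < ‖l‖ := norm_pos_iff.2 hl
  -- The spread is positively homogeneous in l, so the unit sphere suffices.
  have h := hmin (p, ‖l‖⁻¹ • l) ⟨hp, by simp [norm_smul, hn.ne']⟩
  have hscale : ∀ x, max (centered R p.1 (‖l‖⁻¹ • l) x) 0 =
      ‖l‖⁻¹ * max (centered R p.1 l x) 0 := fun x => by
    rw [centered_smul, mul_max_of_nonneg _ _ (inv_nonneg.2 hn.le), mul_zero]
  simp only [hscale] at h
  rw [integral_const_mul, inv_mul_eq_div, le_div_iff₀ hn] at h
  exact h

end Spread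

end Matching

namespace Matching

/-! ### Lipschitz dependence of tilts and tilting parameters -/

section Lipschitz

/-- Strong monotonicity of exp on [-K, ∞), where its derivative is at least exp(-K). -/
lemma exp_neg_mul_sq_le {a b K : ℝ} (ha : -K ≤ a) (hb : -K ≤ b) :
    Real.exp (-K) * (a - b) ^ 2 ≤ (a - b) * (Real.exp a - Real.exp b) := by
  wlog h : b ≤ a generalizing a b
  · have := this hb ha (le_of_not_ge h)
    nlinarith
  have h1 : Real.exp b * (a - b) ≤ Real.exp a - Real.exp b := by
    have h2 : Real.exp a = Real.exp b * Real.exp (a - b) := by rw [← Real.exp_add]; ring_nf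
    nlinarith [Real.add_one_le_exp (a - b), Real.exp_pos b]
  have h3 : Real.exp (-K) * (a - b) ≤ Real.exp b * (a - b) :=
    mul_le_mul_of_nonneg_right (Real.exp_le_exp.2 hb) (by linarith)
  nlinarith

lemma abs_exp_sub_exp_le {a b K : ℝ} (ha : a ≤ K) (hb : b ≤ K) :
    |Real.exp a - Real.exp b| ≤ Real.exp K * |a - b| := by
  wlog h : b ≤ a generalizing a b
  · rw [abs_sub_comm, abs_sub_comm a]
    exact this hb ha (le_of_not_ge h)
  have h1 : Real.exp a - Real.exp b ≤ Real.exp a * (a - b) := by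
    have h2 : Real.exp b = Real.exp a * Real.exp (b - a) := by rw [← Real.exp_add]; ring_nf
    nlinarith [Real.add_one_le_exp (b - a), Real.exp_pos a]
  rw [abs_of_nonneg (sub_nonneg.2 (Real.exp_le_exp.2 h)), abs_of_nonneg (sub_nonneg.2 h)]
  exact h1.trans (mul_le_mul_of_nonneg_right (Real.exp_le_exp.2 ha) (by linarith))

lemma abs_div_sub_div_le {n₁ n₂ z₁ z₂ e a : ℝ} (ha : 0 < a) (h₁ : a ≤ z₁) (h₂ : 0 < z₂)
    (hn : 0 ≤ n₂) (hnz : n₂ ≤ z₂) (he : |n₁ - n₂| ≤ e) (he' : |z₁ - z₂| ≤ e) :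
    |n₁ / z₁ - n₂ / z₂| ≤ 2 * e / a := by
  have hz₁ : 0 < z₁ := ha.trans_le h₁
  have he0 : 0 ≤ e := (abs_nonneg _).trans he
  have heq : n₁ / z₁ - n₂ / z₂ = ((n₁ - n₂) - n₂ / z₂ * (z₁ - z₂)) / z₁ := by
    field_simp
    ring
  have hq : |n₂ / z₂| ≤ 1 := by
    rw [abs_of_nonneg (by positivity)]
    exact (div_le_one h₂).2 hnz
  rw [heq, abs_div, abs_of_pos hz₁]
  refine div_le_div₀ (by positivity) ?_ ha h₁
  calc |(n₁ - n₂) - n₂ / z₂ * (z₁ - z₂)| ≤ |n₁ - n₂| + |n₂ / z₂ * (z₁ - z₂)| := abs_sub _ _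
    _ ≤ e + 1 * e := by
        rw [abs_mul]
        exact add_le_add he (mul_le_mul hq he' (abs_nonneg _) zero_le_one)
    _ = 2 * e := by ring

variable {Ω : Type*} [MeasurableSpace Ω]

/-- Exponential tilts depend in a Lipschitz way on the measure and on the exponent. -/
lemma tvDist_tilted_le {μ₁ μ₂ τ₁ τ₂ : ProbabilityMeasure Ω} {f₁ f₂ : Ω → ℝ} {K δ : ℝ}
    (hf₁ : Measurable f₁) (hf₂ : Measurable f₂) (h₁ : ∀ x, |f₁ x| ≤ K) (h₂ : ∀ x, |f₂ x| ≤ K)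
    (hδ : ∀ x, |f₁ x - f₂ x| ≤ δ) (hτ₁ : (τ₁ : Measure Ω) = (μ₁ : Measure Ω).tilted f₁)
    (hτ₂ : (τ₂ : Measure Ω) = (μ₂ : Measure Ω).tilted f₂) :
    tvDist τ₁ τ₂ ≤ 4 * Real.exp (2 * K) * (tvDist μ₁ μ₂ + δ) := by
  have hexp : ∀ {f : Ω → ℝ} {μ : ProbabilityMeasure Ω}, Measurable f → (∀ x, |f x| ≤ K) →
      Integrable (fun x => Real.exp (f x)) (μ : Measure Ω) :=
    fun hf h => integrable_exp_of_abs_le _ hf h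
  have hZ : ∀ {f : Ω → ℝ} {μ : ProbabilityMeasure Ω}, Measurable f → (∀ x, |f x| ≤ K) →
      Real.exp (-K) ≤ ∫ x, Real.exp (f x) ∂(μ : Measure Ω) := fun hf h =>
    le_integral_of_le _ (hexp hf h) fun x => Real.exp_le_exp.2 (abs_le.1 (h x)).1
  have hreal : ∀ {f : Ω → ℝ} {μ τ : ProbabilityMeasure Ω} {S : Set Ω}, MeasurableSet S →
      (τ : Measure Ω) = (μ : Measure Ω).tilted f →
      (τ : Measure Ω).real S = (∫ x in S, Real.exp (f x) ∂(μ : Measure Ω)) /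
        ∫ x, Real.exp (f x) ∂(μ : Measure Ω) := fun hS hτ => by
    rw [measureReal_def, hτ, tilted_apply_eq_ofReal_integral' _ hS, integral_div,
      ENNReal.toReal_ofReal]
    exact div_nonneg (integral_nonneg fun x => (Real.exp_pos _).le)
      (integral_nonneg fun x => (Real.exp_pos _).le)
  have hdiff : ∀ S : Set Ω, MeasurableSet S →
      |∫ x in S, Real.exp (f₁ x) ∂(μ₁ : Measure Ω) - ∫ x in S, Real.exp (f₂ x) ∂(μ₂ : Measure Ω)| ≤
        Real.exp K * (tvDist μ₁ μ₂ + δ) := fun S hS => by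
    have hA : |∫ x in S, Real.exp (f₁ x) ∂(μ₁ : Measure Ω) -
        ∫ x in S, Real.exp (f₁ x) ∂(μ₂ : Measure Ω)| ≤ Real.exp K * tvDist μ₁ μ₂ := by
      rw [← integral_indicator hS, ← integral_indicator hS]
      refine abs_integral_sub_le_mul_tvDist μ₁ μ₂ (hf₁.exp.indicator hS) fun x => ?_
      refine (norm_indicator_le_norm_self (fun x => Real.exp (f₁ x)) x).trans ?_
      rw [Real.norm_eq_abs, Real.abs_exp]
      exact Real.exp_le_exp.2 (abs_le.1 (h₁ x)).2
    have hC : |∫ x in S, Real.exp (f₁ x) ∂(μ₂ : Measure Ω) -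
        ∫ x in S, Real.exp (f₂ x) ∂(μ₂ : Measure Ω)| ≤ Real.exp K * δ := by
      rw [← integral_sub (hexp hf₁ h₁).integrableOn (hexp hf₂ h₂).integrableOn, ← Real.norm_eq_abs]
      have hδ0 : 0 ≤ δ := by
        obtain ⟨x⟩ : Nonempty Ω := (μ₁ : Measure Ω).nonempty_of_neZero
        exact (abs_nonneg _).trans (hδ x)
      refine (norm_setIntegral_le_of_norm_le_const (C := Real.exp K * δ)
        (measure_lt_top _ _) fun x _ => ?_).trans
        (mul_le_of_le_one_right (by positivity) measureReal_le_one)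
      exact (abs_exp_sub_exp_le (abs_le.1 (h₁ x)).2 (abs_le.1 (h₂ x)).2).trans
        (mul_le_mul_of_nonneg_left (hδ x) (Real.exp_pos _).le)
    calc _ ≤ _ := abs_sub_le _ (∫ x in S, Real.exp (f₁ x) ∂(μ₂ : Measure Ω)) _
      _ ≤ _ := add_le_add hA hC
      _ = _ := by ring
  -- Numerators and normalisations differ by at most exp(K)(tv + δ), with tv the distance of μ₁ and
  -- μ₂, and the normalisations are at least exp(-K). One factor 2 comes from the quotient, the
  -- other from the distance.
  refine (tvDist_le (a := 2 * (Real.exp K * (tvDist μ₁ μ₂ + δ)) / Real.exp (-K))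
    fun S hS => ?_).trans (le_of_eq ?_)
  · rw [hreal hS hτ₁, hreal hS hτ₂]
    refine abs_div_sub_div_le (Real.exp_pos _) (hZ hf₁ h₁)
      ((Real.exp_pos _).trans_le (hZ hf₂ h₂)) (integral_nonneg fun x => (Real.exp_pos _).le)
      (setIntegral_le_integral (hexp hf₂ h₂)
        (Filter.Eventually.of_forall fun x => (Real.exp_pos _).le)) (hdiff S hS) ?_
    simpa using hdiff univ MeasurableSet.univ
  · rw [Real.exp_neg, div_inv_eq_mul, two_mul K, Real.exp_add]
    ring

variable {L : ℕ} {R : Fin L → Ω → ℝ} {m : EuclideanSpace ℝ (Fin L)} {B : ℝ}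

/-- The tilting parameters of two measures with the same target moments differ by at most a
multiple of the total variation distance, as soon as one of the measures has spread moments. -/
lemma norm_sub_le_of_tilted (hR : ∀ i, Measurable (R i)) (hB : ∀ i x, |R i x| ≤ B)
    (hm : ∀ i, |m i| ≤ B) {μ₁ μ₂ : ProbabilityMeasure Ω} {c K : ℝ} (hc : 0 < c)
    (hspread : ∀ l, c * ‖l‖ ≤ ∫ x, max (centered R m l x) 0 ∂(μ₁ : Measure Ω))
    {l₁ l₂ : EuclideanSpace ℝ (Fin L)} (hK₁ : ∀ x, |centered R m l₁ x| ≤ K)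
    (hK₂ : ∀ x, |centered R m l₂ x| ≤ K)
    (h₁ : ∀ l, ∫ x, centered R m l x ∂((μ₁ : Measure Ω).tilted (centered R m l₁)) = 0)
    (h₂ : ∀ l, ∫ x, centered R m l x ∂((μ₂ : Measure Ω).tilted (centered R m l₂)) = 0) :
    ‖l₁ - l₂‖ ≤ Real.exp (2 * K) * (L * (2 * B)) / c ^ 2 * tvDist μ₁ μ₂ := by
  set δ := l₁ - l₂ with hδ
  have hmeas := fun l => measurable_centered (m := m) hR l
  have hbd := fun l => abs_centered_le hB hm l
  have hexpbd : ∀ {l}, (∀ x, |centered R m l x| ≤ K) → ∀ x,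
      |centered R m δ x * Real.exp (centered R m l x)| ≤ L * (2 * B) * ‖δ‖ * Real.exp K :=
    fun hK x => by
      rw [abs_mul, Real.abs_exp]
      exact mul_le_mul (hbd δ x) (Real.exp_le_exp.2 (abs_le.1 (hK x)).2) (Real.exp_pos _).le
        ((abs_nonneg _).trans (hbd δ x))
  have hmeas' := fun l => (hmeas δ).mul (hmeas l).exp
  have hint : ∀ {l} (μ : ProbabilityMeasure Ω), (∀ x, |centered R m l x| ≤ K) →
      Integrable (fun x => centered R m δ x * Real.exp (centered R m l x)) (μ : Measure Ω) :=
    fun μ hK => integrable_of_abs_le μ (hmeas' _) (hexpbd hK)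
  have hzero : ∀ {l} {μ : ProbabilityMeasure Ω},
      (∫ x, centered R m δ x ∂((μ : Measure Ω).tilted (centered R m l)) = 0) →
      ∫ x, centered R m δ x * Real.exp (centered R m l x) ∂(μ : Measure Ω) = 0 := by
    intro l μ h
    rw [integral_tilted] at h
    have hZ : 0 < ∫ x, Real.exp (centered R m l x) ∂(μ : Measure Ω) :=
      integral_exp_pos (integrable_exp_of_abs_le μ (hmeas l) (hbd l))
    have heq : ∀ x, (Real.exp (centered R m l x) /
        ∫ x, Real.exp (centered R m l x) ∂(μ : Measure Ω)) • centered R m δ x =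
        centered R m δ x * Real.exp (centered R m l x) /
          ∫ x, Real.exp (centered R m l x) ∂(μ : Measure Ω) := fun x => by
      rw [smul_eq_mul]; ring
    simp only [heq] at h
    rw [integral_div, div_eq_zero_iff] at h
    exact h.resolve_right hZ.ne'
  have hE₁ := hzero (h₁ δ)
  have hE₂ := hzero (h₂ δ)
  have hsqint : Integrable (fun x => centered R m δ x ^ 2) (μ₁ : Measure Ω) :=
    integrable_of_abs_le μ₁ ((hmeas δ).pow_const 2) (M := (L * (2 * B) * ‖δ‖) ^ 2) fun x => by
      rw [abs_pow]
      exact pow_le_pow_left₀ (abs_nonneg _) (hbd δ x) 2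
  -- With s = c‖δ‖, integrate the pointwise bound 2 s t⁺ - s² ≤ t² and insert the spread.
  have hlower : (c * ‖δ‖) ^ 2 ≤ ∫ x, centered R m δ x ^ 2 ∂(μ₁ : Measure Ω) := by
    have hp := (integrable_centered hR hB hm δ μ₁).pos_part
    have hle : ∫ x, (2 * (c * ‖δ‖) * max (centered R m δ x) 0 - (c * ‖δ‖) ^ 2)
        ∂(μ₁ : Measure Ω) ≤ ∫ x, centered R m δ x ^ 2 ∂(μ₁ : Measure Ω) := by
      refine integral_mono ((hp.const_mul _).sub (integrable_const _)) hsqint fun x => ?_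
      show 2 * (c * ‖δ‖) * max (centered R m δ x) 0 - (c * ‖δ‖) ^ 2 ≤ centered R m δ x ^ 2
      rcases le_total (centered R m δ x) 0 with h | h
      · rw [max_eq_right h]
        nlinarith [sq_nonneg (centered R m δ x), sq_nonneg (c * ‖δ‖)]
      · rw [max_eq_left h]
        nlinarith [sq_nonneg (centered R m δ x - c * ‖δ‖)]
    rw [integral_sub (hp.const_mul _) (integrable_const _), integral_const_mul] at hle
    simp only [integral_const, probReal_univ, one_smul] at hle
    have hs := mul_le_mul_of_nonneg_left (hspread δ)
      (by positivity : (0 : ℝ) ≤ 2 * (c * ‖δ‖))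
    nlinarith
  -- Strong monotonicity of exp bounds the left side by a difference of two μ₁-integrals. The one
  -- weighted by l₁ vanishes by stationarity; the one weighted by l₂ would vanish under μ₂, so it is
  -- of the order of the total variation distance.
  have hupper : Real.exp (-K) * ∫ x, centered R m δ x ^ 2 ∂(μ₁ : Measure Ω) ≤
      L * (2 * B) * ‖δ‖ * Real.exp K * tvDist μ₁ μ₂ := by
    rw [← integral_const_mul]
    have hmono : ∫ x, Real.exp (-K) * centered R m δ x ^ 2 ∂(μ₁ : Measure Ω) ≤
        ∫ x, (centered R m δ x * Real.exp (centered R m l₁ x) -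
          centered R m δ x * Real.exp (centered R m l₂ x)) ∂(μ₁ : Measure Ω) := by
      refine integral_mono (hsqint.const_mul _) ((hint μ₁ hK₁).sub (hint μ₁ hK₂)) fun x => ?_
      have h := exp_neg_mul_sq_le (abs_le.1 (hK₁ x)).1 (abs_le.1 (hK₂ x)).1
      rw [← centered_sub, ← hδ, mul_sub] at h
      exact h
    rw [integral_sub (hint μ₁ hK₁) (hint μ₁ hK₂), hE₁] at hmono
    have htv := abs_integral_sub_le_mul_tvDist μ₁ μ₂ (hmeas' l₂) (hexpbd hK₂)
    simp only [Pi.mul_apply] at htv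
    rw [hE₂, sub_zero] at htv
    linarith [neg_abs_le (∫ x, centered R m δ x * Real.exp (centered R m l₂ x) ∂(μ₁ : Measure Ω))]
  have hnn := tvDist_nonneg μ₁ μ₂
  rcases eq_or_lt_of_le (norm_nonneg δ) with h0 | hpos
  · rw [← h0]
    have hLB : 0 ≤ L * (2 * B) := by
      rcases Nat.eq_zero_or_pos L with rfl | hL
      · simp
      · have := (abs_nonneg _).trans (hm ⟨0, hL⟩)
        positivity
    positivity
  · have h3 : Real.exp (-K) * (c * ‖δ‖) ^ 2 ≤ L * (2 * B) * ‖δ‖ * Real.exp K * tvDist μ₁ μ₂ :=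
      (mul_le_mul_of_nonneg_left hlower (Real.exp_pos _).le).trans hupper
    have h4 : Real.exp (-K) * c ^ 2 * ‖δ‖ ≤ L * (2 * B) * Real.exp K * tvDist μ₁ μ₂ :=
      le_of_mul_le_mul_right (by linarith) hpos
    have h5 := mul_le_mul_of_nonneg_left h4 (Real.exp_pos K).le
    have h6 : Real.exp K * Real.exp (-K) = 1 := by rw [← Real.exp_add]; simp
    have h7 : Real.exp (2 * K) = Real.exp K * Real.exp K := by rw [← Real.exp_add]; ring_nf
    rw [div_mul_eq_mul_div, le_div_iff₀ (by positivity), h7]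
    calc ‖δ‖ * c ^ 2 = Real.exp K * Real.exp (-K) * (‖δ‖ * c ^ 2) := by rw [h6, one_mul]
      _ = Real.exp K * (Real.exp (-K) * c ^ 2 * ‖δ‖) := by ring
      _ ≤ _ := h5
      _ = _ := by ring

end Lipschitz

end Matching

/-! ### The matching domain and the main theorem -/

namespace Matching

variable {Ω : Type*} [TopologicalSpace Ω] [MeasurableSpace Ω] {L : ℕ} {R : Fin L → Ω → ℝ} {B : ℝ}

lemma abs_le_of_mem_matchDomain (hR : ∀ i, Measurable (R i)) (hB : ∀ i x, |R i x| ≤ B)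
    {p : EuclideanSpace ℝ (Fin L) × ProbabilityMeasure Ω} (hp : p ∈ matchDomain R) (i : Fin L) :
    |p.1 i| ≤ B := by
  rcases hp with ⟨_, hp⟩ | hp
  · obtain ⟨ν, _, hν⟩ := interior_subset hp
    exact hν ▸ abs_restriction_le hR hB ν i
  · exact hp ▸ abs_restriction_le hR hB p.2 i

lemma integral_centered_pos_of_mem_matchDomain [OpensMeasurableSpace Ω]
    (hcont : ∀ i, Continuous (R i))
    (hB : ∀ i x, |R i x| ≤ B) {p : EuclideanSpace ℝ (Fin L) × ProbabilityMeasure Ω}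
    (hp : p ∈ matchDomain R) (hnd : NondegenerateMod R p.2) {l : EuclideanSpace ℝ (Fin L)}
    (hl : l ≠ 0) : 0 < ∫ x, max (centered R p.1 l x) 0 ∂(p.2 : Measure Ω) := by
  rcases hp with ⟨_, hp⟩ | hp
  · exact integral_centered_pos_of_mem_interior hcont hB hp hl
  · rw [hp]
    exact integral_centered_pos_of_nondegenerate (fun i => (hcont i).measurable) hB hnd hl

end Matching

theorem theorem4p9 {Ω : Type*} [TopologicalSpace Ω] [PolishSpace Ω] [MeasurableSpace Ω]
    [BorelSpace Ω] {L : ℕ} (R : Fin L → Ω → ℝ)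
    (hcont : ∀ l, Continuous (R l)) (hbdd : ∀ l, ∃ B : ℝ, ∀ x, |R l x| ≤ B)
    (Γ : Set (EuclideanSpace ℝ (Fin L) × ProbabilityMeasure Ω))
    (hΓ : Γ ⊆ Matching.matchDomain R) (hcomp : IsCompact Γ)
    (hnd : ∀ p ∈ closure {q ∈ Γ | q.1 ≠ Matching.restriction R q.2},
      Matching.NondegenerateMod R p.2) :
    (∀ p ∈ Γ, ∃! ν : ProbabilityMeasure Ω, Matching.IsMatching R p.1 p.2 ν) ∧
    ∃ C : ℝ, ∀ (m : EuclideanSpace ℝ (Fin L)) (μ₁ μ₂ : ProbabilityMeasure Ω),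
      (m, μ₁) ∈ Γ → (m, μ₂) ∈ Γ →
        Matching.tvDist (Matching.matching R m μ₁) (Matching.matching R m μ₂) ≤
          C * Matching.tvDist μ₁ μ₂ := by
  obtain ⟨B, hB0, hB⟩ : ∃ B : ℝ, 0 ≤ B ∧ ∀ l x, |R l x| ≤ B := by
    choose b hb using hbdd
    exact ⟨∑ l, |b l|, Finset.sum_nonneg fun l _ => abs_nonneg _, fun l x => (hb l x).trans ((le_abs_self _).trans
      (Finset.single_le_sum (f := fun l => |b l|) (fun i _ => abs_nonneg _) (Finset.mem_univ l)))⟩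
  have hR := fun l => (hcont l).measurable
  have hm := fun p hp => Matching.abs_le_of_mem_matchDomain hR hB (hΓ (a := p) hp)
  set A := {q ∈ Γ | q.1 ≠ Matching.restriction R q.2} with hA
  -- Limits of unmatched pairs stay in Γ, but may themselves satisfy m = E_μ R.
  have hNΓ : closure A ⊆ Γ := closure_minimal (sep_subset _ _) hcomp.isClosed
  obtain ⟨c, hc, hspread⟩ := Matching.exists_uniform_spread hcont hB
    (hcomp.of_isClosed_subset isClosed_closure hNΓ) fun p hp l hl =>
      Matching.integral_centered_pos_of_mem_matchDomain hcont hB (hΓ (hNΓ hp)) (hnd p hp) hl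
  have htilt : ∀ p ∈ Γ, ∃ (l : EuclideanSpace ℝ (Fin L)) (τ : ProbabilityMeasure Ω),
      ‖l‖ ≤ 1 / c ∧ (τ : Measure Ω) = (p.2 : Measure Ω).tilted (Matching.centered R p.1 l) ∧
      ∀ l', ∫ x, Matching.centered R p.1 l' x ∂(τ : Measure Ω) = 0 := fun p hp => by
    by_cases hpm : p.1 = Matching.restriction R p.2
    · refine ⟨0, p.2, by simp [hc.le], (Matching.tilted_centered_zero p.2).symm, fun l' => ?_⟩
      rw [Matching.integral_centered hR hB, hpm]
      simp
    · obtain ⟨l, hl, h0⟩ := Matching.exists_tilt hR hB (hm p hp) p.2 hc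
        (hspread p (subset_closure ⟨hp, hpm⟩))
      exact ⟨l, ⟨_, isProbabilityMeasure_tilted (Matching.integrable_exp_of_abs_le p.2
        (Matching.measurable_centered hR l) (Matching.abs_centered_le hB (hm p hp) l))⟩,
        hl, rfl, h0⟩
  refine ⟨fun p hp => ?_, ?_⟩
  · obtain ⟨l, τ, _, hτ, h0⟩ := htilt p hp
    have hiff := Matching.isMatching_iff_eq_tilted hR hB (hm p hp) hτ h0
    exact ⟨τ, (hiff τ).2 rfl, fun ν hν => (hiff ν).1 hν⟩
  -- M bounds |λ·(R - m)| per unit of ‖λ‖, K bounds the exponents since ‖λ‖ ≤ 1/c, and D is the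
  -- Lipschitz constant of the parameters.
  set M : ℝ := L * (2 * B) with hM
  set K : ℝ := M * (1 / c) with hK
  set D : ℝ := Real.exp (2 * K) * M / c ^ 2 with hD
  set C : ℝ := 4 * Real.exp (2 * K) * (1 + M * D) with hC
  have hM0 : 0 ≤ M := by positivity
  have hmain : ∀ (m : EuclideanSpace ℝ (Fin L)) (μ₁ μ₂ : ProbabilityMeasure Ω),
      (m, μ₁) ∈ A → (m, μ₂) ∈ Γ →
        Matching.tvDist (Matching.matching R m μ₁) (Matching.matching R m μ₂) ≤
          C * Matching.tvDist μ₁ μ₂ := fun m μ₁ μ₂ h₁ h₂ => by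
    obtain ⟨l₁, τ₁, hl₁, hτ₁, h0₁⟩ := htilt _ h₁.1
    obtain ⟨l₂, τ₂, hl₂, hτ₂, h0₂⟩ := htilt _ h₂
    have hmB : ∀ i, |m i| ≤ B := hm _ h₂
    dsimp only at hτ₁ hτ₂ h0₁ h0₂
    rw [Matching.matching_eq_of_forall_iff
        (Matching.isMatching_iff_eq_tilted hR hB hmB hτ₁ h0₁),
      Matching.matching_eq_of_forall_iff (Matching.isMatching_iff_eq_tilted hR hB hmB hτ₂ h0₂)]
    have hbd : ∀ {l : EuclideanSpace ℝ (Fin L)}, ‖l‖ ≤ 1 / c →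
        ∀ x, |Matching.centered R m l x| ≤ K := fun hl x =>
      (Matching.abs_centered_le hB hmB _ x).trans (mul_le_mul_of_nonneg_left hl hM0)
    have hδ := Matching.norm_sub_le_of_tilted hR hB hmB hc (hspread (m, μ₁) (subset_closure h₁))
      (hbd hl₁) (hbd hl₂) (hτ₁ ▸ h0₁) (hτ₂ ▸ h0₂)
    refine (Matching.tvDist_tilted_le (δ := M * (D * Matching.tvDist μ₁ μ₂))
      (Matching.measurable_centered hR l₁)
      (Matching.measurable_centered hR l₂) (hbd hl₁) (hbd hl₂) (fun x => ?_) hτ₁ hτ₂).trans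
      (le_of_eq ?_)
    · rw [← Matching.centered_sub]
      exact (Matching.abs_centered_le hB hmB _ x).trans (mul_le_mul_of_nonneg_left hδ hM0)
    · rw [hC]
      ring
  -- The constant 1 serves two already matched measures. Otherwise one of them is unmatched and, by
  -- symmetry, may take the first place.
  refine ⟨max 1 C, fun m μ₁ μ₂ h₁ h₂ => ?_⟩
  have hnn := Matching.tvDist_nonneg μ₁ μ₂
  have hCmax := mul_le_mul_of_nonneg_right (le_max_right 1 C) hnn
  by_cases hm₁ : m = Matching.restriction R μ₁
  · by_cases hm₂ : m = Matching.restriction R μ₂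
    · have hself : ∀ μ : ProbabilityMeasure Ω, (m, μ) ∈ Γ → m = Matching.restriction R μ →
          Matching.matching R m μ = μ := fun μ hμ hmμ =>
        Matching.matching_eq_of_forall_iff (Matching.isMatching_iff_eq_tilted hR hB (hm _ hμ)
          (Matching.tilted_centered_zero μ).symm
          fun l' => by rw [Matching.integral_centered hR hB, hmμ]; simp)
      rw [hself μ₁ h₁ hm₁, hself μ₂ h₂ hm₂]
      exact le_mul_of_one_le_left hnn (le_max_left 1 C)
    · rw [Matching.tvDist_comm μ₁, Matching.tvDist_comm (Matching.matching R m μ₁)]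
      rw [Matching.tvDist_comm μ₁] at hCmax
      exact (hmain m μ₂ μ₁ ⟨h₂, hm₂⟩ h₁).trans hCmax
  · exact (hmain m μ₁ μ₂ ⟨h₁, hm₁⟩ h₂).trans hCmax
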